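/- Fix an integer $k \ge 1$. For finite binary words $u, w$ with $w$ nonempty, let $|u|_w$ be the number of occurrences of $w$ as a factor of $u$. Two finite binary words $u, v$ are $k$-abelian equivalent if $|u|_w = |v|_w$ for every nonempty word $w$ of length at most $k$. A concatenation $u_0 u_1 \cdots u_{n-1}$ of $n$ pairwise $k$-abelian equivalent words of length $m$ is a $k$-abelian power of exponent $n$ and period $m$. For irrational $\alpha$ and $x \in [0,1)$, the Sturmian word of slope $\alpha$ and intercept $x$ is the infinite word over $\{0,1\}$ whose $n$-th letter ($n \ge 0$) is $0$ if $\{x + n\alpha\} \in I_0$ and $1$ otherwise, where $\{\cdot\}$ is the fractional part, and where $I_0$ is either $[0, \{1-\alpha\})$ or $(0, \{1-\alpha\}]$. For $m \ge 1$ let $\mathcal{E}_{k,\alpha}(m)$ be the maximum exponent of a $k$-abelian power of period $m$ occurring in a Sturmian word of slope $\alpha$ (the exponent $1$ being allowed), and let $$\theta_k(\alpha) = \limsup_{m \to \infty} \frac{\mathcal{E}_{k,\alpha}(m)}{m} \in [0, \infty].$$ The $k$-Lagrange spectrum is the set $\mathcal{L}_k = \{\theta_k(\alpha) : \alpha \in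 \mathbb{R} \text{ irrational}\} \cap \mathbb{R}$. Theorem. Let $k > 1$. Then $$\mathcal{L}_k \subseteq \left(\frac{\sqrt{5}}{2k-1}, \infty\right),$$ and $\frac{\sqrt{5}}{2k-1}$ is the least accumulation point of $\mathcal{L}_k$ in $\mathbb{R}$. In particular, the set $\mathcal{L}_k$ is not closed in $\mathbb{R}$. -/

import Mathlib

namespace KLagrange

/-- Finite binary words. -/
abbrev Word : Type := List (Fin 2)

/-- The number of occurrences of the (nonempty) word `w` as a factor of `u`,
overlapping occurrences included. -/
def occ (w u : Word) : ℕ :=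
  ((Finset.range u.length).filter (fun i => w <+: u.drop i)).card

/-- `k`-abelian equivalence: equal numbers of occurrences of every nonempty word of length at
most `k`. -/
def KAbelianEquiv (k : ℕ) (u v : Word) : Prop :=
  ∀ w : Word, w ≠ [] → w.length ≤ k → occ w u = occ w v

/-- `u` is a `k`-abelian power of exponent `n` and period `m`: a concatenation of `n` words of
length `m` that are pairwise `k`-abelian equivalent. -/
def IsKAbelianPower (k n m : ℕ) (u : Word) : Prop :=
  ∃ v : Fin n → Word, (∀ i, (v i).length = m) ∧ (∀ i j, KAbelianEquiv k (v i) (v j)) ∧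
    u = (List.ofFn v).flatten

/-- The finite word `u` occurs in the infinite word `s`. -/
def OccursIn (u : Word) (s : ℕ → Fin 2) : Prop :=
  ∃ i : ℕ, ∀ j : Fin u.length, u.get j = s (i + j)

open Classical in
/-- The Sturmian word of slope `α` and intercept `x` for the partition
`I₀ = [0, {1 - α})`, `I₁ = [{1 - α}, 1)`. The `n`-th iterate of the rotation by `α` maps the
point `x` to the fractional part of `x + n α`. -/
noncomputable def lowerSturmian (α x : ℝ) (n : ℕ) : Fin 2 :=
  if Int.fract (x + n * α) < Int.fract (1 - α) then 0 else 1

open Classical in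
/-- The Sturmian word of slope `α` and intercept `x` for the partition
`I₀ = (0, {1 - α}]`, `I₁ = ({1 - α}, 1]`. On the circle the point `1` is the point `0`,
so that the point with fractional part `0` belongs to `I₁`. -/
noncomputable def upperSturmian (α x : ℝ) (n : ℕ) : Fin 2 :=
  if 0 < Int.fract (x + n * α) ∧ Int.fract (x + n * α) ≤ Int.fract (1 - α) then 0 else 1

/-- `s` is a Sturmian word of slope `α` (for either choice of the partition). -/
def IsSturmian (α : ℝ) (s : ℕ → Fin 2) : Prop :=
  ∃ x ∈ Set.Ico (0 : ℝ) 1, s = lowerSturmian α x ∨ s = upperSturmian α x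

/-- The exponents of the `k`-abelian powers of period `m` that occur in a Sturmian word of slope
`α`. The trivial exponent `1` always belongs to the set. -/
def exponents (k : ℕ) (α : ℝ) (m : ℕ) : Set ℕ :=
  {n | 1 ≤ n ∧ ∃ (u : Word) (s : ℕ → Fin 2),
    IsSturmian α s ∧ OccursIn u s ∧ IsKAbelianPower k n m u}

/-- The maximum exponent of `k`-abelian powers of period `m` occurring in a Sturmian word of
slope `α`; it is `1` if there is no nondegenerate one (that is, of exponent at least `2`). -/
noncomputable def maxExponent (k : ℕ) (α : ℝ) (m : ℕ) : ℕ∞ :=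
  ⨆ n ∈ exponents k α m, (n : ℕ∞)

/-- The `k`-abelian critical exponent of slope `α`, in `[0, ∞]`. -/
noncomputable def criticalExponent (k : ℕ) (α : ℝ) : ENNReal :=
  Filter.limsup (fun m : ℕ => (maxExponent k α m : ENNReal) / (m : ENNReal)) Filter.atTop

/-- The `k`-Lagrange spectrum: the finite `k`-abelian critical exponents of irrational slopes. -/
def lagrangeSpectrum (k : ℕ) : Set ℝ :=
  {y | ∃ α : ℝ, Irrational α ∧ criticalExponent k α ≠ ⊤ ∧ (criticalExponent k α).toReal = y}

end KLagrange

namespace KLagrange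

/-! Let ‖mα‖ be the distance from mα to the nearest integer. The blocks of a k-abelian power of
period m start at rotation points that advance by ±‖mα‖, and equivalence of the blocks essentially
means that these points are not separated by any of the 2k - 1 points -jα mod 1, |j| < k. So the
maximal exponent is about g / ‖mα‖, where g is the longest gap these points leave on the circle, and
the critical exponent should be g · limsup 1 / (m‖mα‖). Only the two inequalities needed below are
proved.

Lower bound, for every slope: 2k - 1 points leave a gap of length at least 1 / (2k - 1), and
equality is excluded because α is irrational (`exists_gap`). Hurwitz's theorem (`hurwitz`) makes the
limsup at least √5, and `mem_exponents` turns a run of points inside the gap into a power. The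
strict inequality of the theorem comes from the gap alone.

Upper bound, for special slopes: take α equivalent to the golden ratio and very close to 1 / (2k -
1). Its approximation constant is still √5 (`eventually_of_discrim_eq_five`), while the points -jα
are almost equally spaced (`exists_int_between`), so `IsRounding.mul_abs_le` gives critical
exponents arbitrarily close to √5 / (2k - 1). This value is therefore an accumulation point that the
spectrum does not contain, and nothing smaller can be one. -/

/-! ### Farey pairs and Hurwitz's theorem. -/

/-- `a / b < α < c / d` is a pair of fractions of determinant one around `α`. -/
structure IsFareyPair (α : ℝ) (a b c d : ℤ) : Prop where
  left_pos : 0 < b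
  right_pos : 0 < d
  left_lt : (a : ℝ) < b * α
  lt_right : d * α < (c : ℝ)
  det : b * c - a * d = 1

lemma IsFareyPair.neg {α : ℝ} {a b c d : ℤ} (h : IsFareyPair α a b c d) :
    IsFareyPair (-α) (-c) d (-a) b where
  left_pos := h.right_pos
  right_pos := h.left_pos
  left_lt := by have := h.lt_right; push_cast; linarith
  lt_right := by have := h.left_lt; push_cast; linarith
  det := by have := h.det; linarith

lemma mul_ne_int {α : ℝ} (hα : Irrational α) {b : ℤ} (hb : b ≠ 0) (a : ℤ) : (b : ℝ) * α ≠ a := by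
  intro h
  exact (hα.intCast_mul hb).ne_int a h

/-- Add the left fraction repeatedly to the right one; the first mediant that falls below α is the
new left end, and the mediant before it the new right end. -/
lemma IsFareyPair.exists_left {α : ℝ} (hα : Irrational α) {a b c d : ℤ}
    (h : IsFareyPair α a b c d) :
    ∃ a' b' c' d', IsFareyPair α a' b' c' d' ∧ b + 1 ≤ b' ∧ d ≤ d' := by
  classical
  have hx : 0 < b * α - a := by linarith [h.left_lt]
  have hex : ∃ n : ℕ, (c + n * a : ℝ) < (d + n * b) * α := by
    obtain ⟨n, hn⟩ := exists_nat_gt ((c - d * α) / (b * α - a))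
    refine ⟨n, ?_⟩
    rw [div_lt_iff₀ hx] at hn
    linarith
  obtain ⟨n, hn, hmin⟩ : ∃ n : ℕ, (c + n * a : ℝ) < (d + n * b) * α ∧
      ∀ i < n, ¬ (c + i * a : ℝ) < (d + i * b) * α :=
    ⟨Nat.find hex, Nat.find_spec hex, fun i hi => Nat.find_min hex hi⟩
  have hb := h.left_pos
  have hd := h.right_pos
  rcases n with _ | n
  · exfalso
    have := h.lt_right
    simp at hn
    linarith
  have hle := hmin n (Nat.lt_succ_self n)
  have hpos : 0 < d + n * b := by positivity
  refine ⟨c + (n + 1) * a, d + (n + 1) * b, c + n * a, d + n * b, ⟨by positivity, hpos, ?_, ?_, ?_⟩,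
    ?_, ?_⟩
  · push_cast at hn ⊢; linarith
  · have hne := mul_ne_int hα hpos.ne' (c + n * a)
    push_cast at hne ⊢
    exact lt_of_le_of_ne (not_lt.mp hle) hne
  · linear_combination h.det
  · nlinarith
  · nlinarith

lemma IsFareyPair.exists_right {α : ℝ} (hα : Irrational α) {a b c d : ℤ}
    (h : IsFareyPair α a b c d) :
    ∃ a' b' c' d', IsFareyPair α a' b' c' d' ∧ b ≤ b' ∧ d + 1 ≤ d' := by
  obtain ⟨a', b', c', d', h', h1, h2⟩ := h.neg.exists_left hα.neg
  exact ⟨_, _, _, _, by simpa using h'.neg, h2, h1⟩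

lemma exists_isFareyPair {α : ℝ} (hα : Irrational α) (M : ℕ) :
    ∃ a b c d : ℤ, IsFareyPair α a b c d ∧ (M : ℤ) ≤ b ∧ (M : ℤ) ≤ d := by
  induction M with
  | zero =>
    refine ⟨⌊α⌋, 1, ⌊α⌋ + 1, 1, ⟨one_pos, one_pos, ?_, ?_, by ring⟩, by simp, by simp⟩
    · have := (hα.ne_int ⌊α⌋).symm
      simpa using lt_of_le_of_ne (Int.floor_le α) this
    · simp
  | succ M ih =>
    obtain ⟨a, b, c, d, h, hb, hd⟩ := ih
    obtain ⟨a, b', c, d', h, hb', hd'⟩ := h.exists_left hα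
    obtain ⟨a, b'', c, d'', h, hb'', hd''⟩ := h.exists_right hα
    exact ⟨_, _, _, _, h, by push_cast; omega, by push_cast; omega⟩

lemma sqrt_five_mul_ne {p q : ℤ} (hq : q ≠ 0) : √5 * q ≠ p := by
  have h5 : Irrational √5 := by
    have := Nat.Prime.irrational_sqrt (p := 5) (by norm_num)
    exact_mod_cast this
  exact (h5.mul_intCast hq).ne_int p

/-- If three products along a Farey pair and its mediant are all large, then `√5` is rational. -/
lemma hurwitz_aux {b d : ℤ} (hb : 0 < b) (hd : 0 < d) {x y : ℝ} (hdet : d * x + b * y = 1)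
    (hx : 1 ≤ √5 * (b * x)) (hy : 1 ≤ √5 * (d * y)) (hxy : 1 ≤ √5 * ((b + d) * (x - y))) :
    False := by
  set s := √5 with hs
  have hb' : (0 : ℝ) < b := by exact_mod_cast hb
  have hd' : (0 : ℝ) < d := by exact_mod_cast hd
  have hs2 : s * s = 5 := Real.mul_self_sqrt (by norm_num)
  have hs0 : 0 ≤ s := Real.sqrt_nonneg 5
  have hs3 : s < 3 := by nlinarith
  have key : ∀ {b d x y : ℝ}, 0 < b → 0 < d → d * x + b * y = 1 → 1 ≤ s * (b * x) →
      1 ≤ s * (d * y) → d ^ 2 + b ^ 2 ≤ s * (b * d) := by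
    intro b d x y hb hd h hx hy
    have h1 := mul_le_mul_of_nonneg_left hx (sq_nonneg d)
    have h2 := mul_le_mul_of_nonneg_left hy (sq_nonneg b)
    have : d ^ 2 * (s * (b * x)) + b ^ 2 * (s * (d * y)) = s * (b * d) := by
      linear_combination (s * b * d) * h
    linarith
  have h1 := key hb' hd' hdet hx hy
  have h2 := key (b := (b : ℝ) + d) (d := d) (x := x - y) (y := y) (by positivity) hd'
    (by linear_combination hdet) hxy hy
  -- The first factorization confines b / d to [(√5 - 1)/2, (√5 + 1)/2]; the second, from the
  -- mediant, forces b / d ≤ (√5 - 1)/2. Equality would make √5 rational.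
  have e1 : (b - (s - 1) / 2 * d) * (b - (s + 1) / 2 * d) ≤ (0 : ℝ) := by
    nlinarith
  have e2 : (b + (3 - s) / 2 * d) * (b - (s - 1) / 2 * d) ≤ (0 : ℝ) := by
    nlinarith
  have p1 : 0 < b + (3 - s) / 2 * d := by
    have : 0 < (3 - s) / 2 * d := by apply mul_pos <;> linarith
    linarith
  have l1 : b - (s - 1) / 2 * d ≤ (0 : ℝ) := by
    by_contra! hc
    exact absurd e2 (not_le.mpr (mul_pos p1 hc))
  have l2 : b - (s + 1) / 2 * d < (0 : ℝ) := by linarith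
  have l3 : 0 ≤ b - (s - 1) / 2 * (d : ℝ) := by
    by_contra! hc
    exact absurd e1 (not_le.mpr (mul_pos_of_neg_of_neg hc l2))
  have : s * d = ((2 * b + d : ℤ) : ℝ) := by push_cast; linarith
  exact sqrt_five_mul_ne hd.ne' this

/-- **Hurwitz's theorem** on rational approximation. -/
theorem hurwitz {α : ℝ} (hα : Irrational α) (M : ℕ) :
    ∃ m : ℕ, M ≤ m ∧ ∃ p : ℤ, √5 * (m * |m * α - p|) < 1 := by
  suffices H : ∃ m : ℤ, (M : ℤ) ≤ m ∧ ∃ p : ℤ, √5 * (m * |m * α - p|) < 1 by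
    obtain ⟨m, hm, p, h⟩ := H
    lift m to ℕ using by omega
    exact ⟨m, by exact_mod_cast hm, p, by exact_mod_cast h⟩
  obtain ⟨a, b, c, d, h, hb, hd⟩ := exists_isFareyPair hα M
  by_contra! hcon
  have hx : 0 < b * α - a := by linarith [h.left_lt]
  have hy : 0 < c - d * α := by linarith [h.lt_right]
  have hdet : d * (b * α - a) + b * (c - d * α) = 1 := by
    have : (b * c - a * d : ℝ) = 1 := by exact_mod_cast h.det
    linear_combination this
  have h1 := hcon b hb a
  have h2 := hcon d hd c
  have h3 := hcon (b + d) (by have := h.right_pos; omega) (a + c)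
  rw [abs_of_pos hx] at h1
  rw [abs_sub_comm, abs_of_pos hy] at h2
  push_cast at h3
  have e : (b + d) * α - (a + c) = (b * α - a) - (c - d * α) := by ring
  rw [e] at h3
  -- The sign tells on which side of α the mediant lies; the second case exchanges the roles of the
  -- two fractions.
  rcases abs_cases ((b * α - a) - (c - d * α)) with ⟨ha, -⟩ | ⟨ha, -⟩
  · rw [ha] at h3
    exact hurwitz_aux h.left_pos h.right_pos hdet h1 h2 h3
  · rw [ha] at h3
    refine hurwitz_aux h.right_pos h.left_pos (by linarith) h2 h1 ?_
    linarith

/-! ### Quadratic irrationals of discriminant five. -/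

/-- Roots of integral quadratic polynomials of discriminant five are approximated no better
than the golden ratio. -/
lemma one_le_of_discrim_eq_five {A B C : ℤ} (hdisc : B ^ 2 - 4 * A * C = 5) {α : ℝ}
    (hroot : A * α ^ 2 + B * α + C = 0) {q : ℤ} (hq : 0 < q) (p : ℤ) :
    1 ≤ √5 * (q * |q * α - p|) + |(A : ℝ)| * |q * α - p| ^ 2 := by
  -- The binary quadratic form has no nontrivial integer zero, so its absolute value is at least 1;
  -- expanding it around the root α gives the bound.
  have hf : A * p ^ 2 + B * p * q + C * q ^ 2 ≠ 0 := by
    intro h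
    have h1 : (2 * A * p + B * q) ^ 2 = 5 * q ^ 2 := by
      linear_combination 4 * A * h + q ^ 2 * hdisc
    have h2 : √5 * q = |((2 * A * p + B * q : ℤ) : ℝ)| := by
      rw [← Real.sqrt_sq_eq_abs, ← Int.cast_pow, h1]
      push_cast
      rw [Real.sqrt_mul (by norm_num), Real.sqrt_sq (by exact_mod_cast hq.le)]
    exact sqrt_five_mul_ne hq.ne' (p := |2 * A * p + B * q|) (by rw [h2]; simp)
  have hdisc' : (B ^ 2 - 4 * A * C : ℝ) = 5 := by exact_mod_cast hdisc
  have h5 : |2 * A * α + B| = √5 := by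
    rw [← Real.sqrt_sq_eq_abs]
    congr 1
    linear_combination 4 * A * hroot + hdisc'
  have h1 : (1 : ℝ) ≤ |A * (p : ℝ) ^ 2 + B * p * q + C * q ^ 2| := by
    exact_mod_cast Int.one_le_abs hf
  have e : A * (p : ℝ) ^ 2 + B * p * q + C * q ^ 2 =
      -((2 * A * α + B) * (q * (q * α - p))) + A * (q * α - p) ^ 2 := by
    linear_combination (q : ℝ) ^ 2 * hroot
  rw [e] at h1
  refine h1.trans ((abs_add_le _ _).trans ?_)
  rw [abs_neg, abs_mul, abs_mul, abs_mul, abs_pow, h5, abs_of_pos (a := (q : ℝ)) (by exact_mod_cast hq)]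

lemma irrational_of_discrim_eq_five {A B C : ℤ} (hdisc : B ^ 2 - 4 * A * C = 5) {α : ℝ}
    (hroot : A * α ^ 2 + B * α + C = 0) : Irrational α := by
  rintro ⟨r, rfl⟩
  have hden : (0 : ℤ) < r.den := by exact_mod_cast r.pos
  have := one_le_of_discrim_eq_five hdisc hroot hden r.num
  have hz : ((r.den : ℤ) : ℝ) * (r : ℝ) - r.num = 0 := by
    have : (r.den : ℚ) * r = r.num := Rat.den_mul_eq_num r
    have : (r.den : ℝ) * r = r.num := by exact_mod_cast this
    push_cast; linarith
  rw [hz] at this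
  norm_num at this

/-- Take α = 1 / (K + 1/β) with β = N + (1 + √5)/2 and N large. The coefficients come from
substituting β = α / (1 - Kα) into (β - N)² - (β - N) - 1 = 0; this substitution is unimodular and
preserves the discriminant. -/
lemma exists_discrim_eq_five (K : ℕ) (hK : 0 < K) {δ : ℝ} (hδ : 0 < δ) :
    ∃ (A B C : ℤ) (α : ℝ), B ^ 2 - 4 * A * C = 5 ∧ A * α ^ 2 + B * α + C = 0 ∧
      |α - 1 / K| < δ := by
  obtain ⟨N, hN⟩ := exists_nat_gt (1 / δ)
  set β : ℝ := N + (1 + √5) / 2 with hβ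
  have h5 : √5 ^ 2 = 5 := Real.sq_sqrt (by norm_num)
  have hβN : (N : ℝ) < β := by
    have := Real.sqrt_nonneg 5
    rw [hβ]; linarith
  have hN0 : (0 : ℝ) < N := lt_trans (by positivity) hN
  have hβ0 : 0 < β := by linarith
  have hK1 : (1 : ℝ) ≤ K := by exact_mod_cast hK
  have hD : 0 < K * β + 1 := by positivity
  refine ⟨(1 + N * K) ^ 2 + K * (1 + N * K) - K ^ 2,
    -2 * N * (1 + N * K) - (1 + N * K) - N * K + 2 * K, N ^ 2 + N - 1, β / (K * β + 1),
    by ring, ?_, ?_⟩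
  · have : (β - N) ^ 2 - (β - N) - 1 = 0 := by
      rw [hβ]; linear_combination (1 / 4) * h5
    push_cast
    field_simp
    linear_combination this
  · have e : β / (K * β + 1) - 1 / K = -(1 / (K * (K * β + 1))) := by
      field_simp; ring
    rw [e, abs_neg, abs_of_pos (by positivity)]
    rw [one_div_lt (by positivity) hδ]
    refine hN.trans (hβN.trans ?_)
    nlinarith

/-- The approximation constant of a root of discriminant five is at least `1 / √5`. -/
lemma eventually_of_discrim_eq_five {A B C : ℤ} (hdisc : B ^ 2 - 4 * A * C = 5) {α : ℝ}
    (hroot : A * α ^ 2 + B * α + C = 0) {r : ℝ} (hr : √5 < r) :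
    ∀ᶠ m : ℕ in Filter.atTop, ∀ p : ℤ, 1 < r * (m * |m * α - p|) := by
  have h5 : 0 < √5 := by positivity
  have hr0 : 0 < r := h5.trans hr
  -- If r·m·e ≤ 1 with e = |mα - p|, the previous bound gives (r - √5)·m ≤ |A|·e ≤ |A| / (r·m),
  -- which fails beyond this M.
  obtain ⟨M, hM⟩ := exists_nat_gt (|(A : ℝ)| / (r * (r - √5)))
  filter_upwards [Filter.eventually_gt_atTop M, Filter.eventually_gt_atTop 0] with m hm hm0 p
  have hm0' : (1 : ℝ) ≤ m := by exact_mod_cast hm0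
  have hmM : |(A : ℝ)| / (r * (r - √5)) < m := hM.trans (by exact_mod_cast hm)
  rw [div_lt_iff₀ (mul_pos hr0 (by linarith))] at hmM
  by_contra! hcon
  have h1 := one_le_of_discrim_eq_five hdisc hroot (q := m) (by exact_mod_cast hm0) p
  rw [Int.cast_natCast] at h1
  set e := |m * α - p| with he
  have he0 : 0 ≤ e := abs_nonneg _
  have hme : 0 ≤ m * e := by positivity
  rcases he0.eq_or_lt with h0 | hepos
  · rw [← h0] at h1; norm_num at h1
  have h2 : (r - √5) * (m * e) ≤ |(A : ℝ)| * e ^ 2 := by linarith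
  have h3 : (r - √5) * m ≤ |(A : ℝ)| * e := by
    have : ((r - √5) * m) * e ≤ (|(A : ℝ)| * e) * e := by linarith
    exact le_of_mul_le_mul_right this hepos
  have h4 : r * m * ((r - √5) * m) ≤ r * m * (|(A : ℝ)| * e) :=
    mul_le_mul_of_nonneg_left h3 (by positivity)
  have h5 : |(A : ℝ)| * (r * (m * e)) ≤ |(A : ℝ)| * 1 :=
    mul_le_mul_of_nonneg_left hcon (abs_nonneg _)
  have h6 : m * (r * (r - √5)) * 1 ≤ m * (r * (r - √5)) * m :=
    mul_le_mul_of_nonneg_left hm0' (mul_nonneg (by positivity) (mul_nonneg hr0.le (by linarith)))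
  linarith


/-! ### Gaps between the points -jα, |j| < k, on the circle. -/

/-- The `2k - 1` points `-jα`, `|j| < k`, of the circle leave a gap longer than `1 / (2k - 1)`. -/
lemma exists_gap {α : ℝ} (hα : Irrational α) {k : ℕ} (hk : 1 < k) :
    ∃ a b : ℝ, 1 / (2 * (k : ℝ) - 1) < b - a ∧ ∀ j : ℤ, |j| < k → ⌊a + j * α⌋ = ⌊b + j * α⌋ := by
  have hk' : (2 : ℝ) ≤ k := by exact_mod_cast hk
  set K : ℝ := 2 * (k : ℝ) - 1 with hK
  have hK0 : 0 < K := by linarith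
  let T : Set ℝ := {z | ∃ j q : ℤ, |j| < k ∧ z = q - j * α}
  have h0T : (0 : ℝ) ∈ T := ⟨0, 0, by simp; omega, by simp⟩
  have hne : ∀ s ∈ T, ∀ t ∈ T, t ≠ s + 1 / K := by
    rintro s ⟨j, q, -, rfl⟩ t ⟨j', q', -, rfl⟩ h
    have h1 : K * (j' - j) * α = K * (q' - q) - 1 := by
      field_simp at h; linear_combination -h
    by_cases hj : j' = j
    · subst hj
      have h2 : (2 * (k : ℤ) - 1) * (q' - q) = 1 := by
        rify; rw [← hK]; linarith
      rcases Int.mul_eq_one_iff_eq_one_or_neg_one.mp h2 with h3 | h3 <;> omega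
    · refine mul_ne_int hα (b := (2 * (k : ℤ) - 1) * (j' - j)) (mul_ne_zero (by omega) (by omega))
        ((2 * (k : ℤ) - 1) * (q' - q) - 1) ?_
      push_cast
      rw [← hK]; exact h1
  -- Otherwise steps shorter than 1 / K lead from 0 through 2k distinct points of `T` in [0, 1). Two
  -- of them share the index j, so they differ by a nonzero integer, which is impossible.
  obtain ⟨s, hs⟩ : ∃ s, ∀ t ∈ T, s < t → ¬ t ≤ s + 1 / K := by
    by_contra! hcon
    have hnext : ∀ s : T, ∃ t : T, (s : ℝ) < t ∧ (t : ℝ) < s + 1 / K := by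
      rintro ⟨s, hs⟩
      obtain ⟨t, ht, h1, h2⟩ := hcon s
      exact ⟨⟨t, ht⟩, h1, lt_of_le_of_ne h2 (hne s hs t ht)⟩
    choose f hf1 hf2 using hnext
    let z : ℕ → T := fun n => f^[n] ⟨0, h0T⟩
    have hz : ∀ n, z (n + 1) = f (z n) := fun n => Function.iterate_succ_apply' f n _
    have hmono : StrictMono (fun n => (z n : ℝ)) :=
      strictMono_nat_of_lt_succ fun n => by rw [hz]; exact hf1 _
    have hub : ∀ n, (z (n + 1) : ℝ) < (n + 1) / K := by
      intro n
      induction n with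
      | zero => rw [hz]; have := hf2 (z 0); simpa [z] using this
      | succ n ih =>
        rw [hz]
        have := hf2 (z (n + 1))
        push_cast
        have e : ((n : ℝ) + 1 + 1) / K = (n + 1) / K + 1 / K := by ring
        rw [e]; linarith
    have hnn : ∀ n, 0 ≤ (z n : ℝ) := fun n => hmono.monotone (Nat.zero_le n)
    have hlt : ∀ n < 2 * k, (z n : ℝ) < 1 := by
      intro n hn
      rcases n with _ | n
      · simp [z]
      refine (hub n).trans_le ?_
      rw [div_le_one hK0]
      have : ((n + 1 : ℕ) : ℝ) ≤ (2 * k - 1 : ℕ) := by exact_mod_cast (by omega)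
      rw [Nat.cast_sub (by omega)] at this
      push_cast at this
      linarith
    choose j q hj hjq using fun n => (z n).2
    obtain ⟨n, hn, n', hn', hnn', hjj⟩ := Finset.exists_ne_map_eq_of_card_lt_of_maps_to
      (s := Finset.range (2 * k)) (t := Finset.Ioo (-(k : ℤ)) k) (f := j)
      (by simp; omega) (fun n _ => by simpa [abs_lt] using hj n)
    apply hnn'
    apply hmono.injective
    have h1 := hlt n (by simpa using hn)
    have h2 := hlt n' (by simpa using hn')
    have h3 := hnn n
    have h4 := hnn n'
    simp only
    rw [hjq] at h1 h2 h3 h4 ⊢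
    rw [hjq, hjj]
    rw [hjj] at h1 h3
    have h5 : (q n : ℝ) < q n' + 1 := by linarith
    have h6 : (q n' : ℝ) < q n + 1 := by linarith
    norm_cast at h5 h6
    have : q n = q n' := by omega
    rw [this]
  have hfl : ∀ j : ℤ, |j| < k → ⌊s + j * α⌋ = ⌊s + 1 / K + j * α⌋ := by
    intro j hj
    by_contra hne
    have hle : ⌊s + j * α⌋ ≤ ⌊s + 1 / K + j * α⌋ := by
      apply Int.floor_le_floor
      have : 0 < 1 / K := by positivity
      linarith
    have hlt := Int.floor_lt.mp (lt_of_le_of_ne hle hne)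
    refine hs (⌊s + 1 / K + j * α⌋ - j * α) ⟨j, _, hj, rfl⟩ (by linarith) ?_
    have := Int.floor_le (s + 1 / K + j * α)
    linarith
  -- Right continuity of the floor allows the right end to move slightly past s + 1 / K, which makes
  -- the gap strictly longer.
  have hev : ∀ᶠ b in nhdsWithin (s + 1 / K) (Set.Ioi (s + 1 / K)),
      ∀ j ∈ Finset.Ioo (-(k : ℤ)) k, b + j * α < ⌊s + 1 / K + j * α⌋ + 1 := by
    rw [Filter.eventually_all_finset]
    intro j _
    apply eventually_nhdsWithin_of_eventually_nhds
    have hc : Continuous fun b : ℝ => b + j * α := by fun_prop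
    exact hc.continuousAt.eventually_lt_const (Int.lt_floor_add_one _)
  obtain ⟨b, hb, hsb⟩ := (hev.and self_mem_nhdsWithin).exists
  have hsb' : s + 1 / K < b := hsb
  refine ⟨s, b, by linarith, fun j hj => ?_⟩
  rw [hfl j hj, eq_comm, Int.floor_eq_iff]
  refine ⟨?_, hb j (by simpa [abs_lt] using hj)⟩
  have := Int.floor_le (s + 1 / K + j * α)
  linarith

/-- If `α` is close to `1 / (2k - 1)`, then every interval slightly longer than `1 / (2k - 1)`
contains one of the points `-jα`, `|j| < k`, modulo one. -/
lemma exists_int_between {α η : ℝ} {k : ℕ} (hk : 1 < k)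
    (hα : |α - 1 / (2 * (k : ℝ) - 1)| ≤ η) {y z : ℝ}
    (hyz : 1 / (2 * (k : ℝ) - 1) + 2 * k * η < z - y) :
    ∃ j q : ℤ, |j| < k ∧ y + j * α < q ∧ q < z + j * α := by
  have hk' : (2 : ℝ) ≤ k := by exact_mod_cast hk
  set K : ℝ := 2 * (k : ℝ) - 1 with hK
  have hK0 : 0 < K := by linarith
  -- R / K is the first multiple of 1 / K beyond y + kη. Balanced division writes R = Kq - j with
  -- |j| < k, and q - jα is then within kη of R / K.
  set R : ℤ := ⌊K * (y + k * η)⌋ + 1 with hR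
  set q : ℤ := (R + (k - 1)) / (2 * k - 1) with hq
  have hdiv := Int.emod_add_mul_ediv (R + (k - 1)) (2 * k - 1)
  have hr0 := Int.emod_nonneg (R + (k - 1)) (b := 2 * k - 1) (by omega)
  have hr1 := Int.emod_lt_of_pos (R + (k - 1)) (b := 2 * k - 1) (by omega)
  rw [← hq] at hdiv
  set j : ℤ := (2 * k - 1) * q - R with hj
  have hjk : |j| < k := by rw [abs_lt]; constructor <;> linarith
  refine ⟨j, q, hjk, ?_⟩
  have hη : 0 ≤ η := (abs_nonneg _).trans hα
  have hjα : |j * (α - 1 / K)| ≤ k * η := by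
    rw [abs_mul]
    have : |(j : ℝ)| ≤ k := by exact_mod_cast hjk.le
    gcongr
  have hjR : (j : ℝ) / K = q - R / K := by
    rw [hj]; push_cast; rw [← hK]; field_simp
  have hRl : y + k * η < R / K := by
    rw [lt_div_iff₀ hK0, hR]
    push_cast
    have := Int.lt_floor_add_one (K * (y + k * η))
    linarith
  have hRu : R / K ≤ y + k * η + 1 / K := by
    rw [div_le_iff₀ hK0, hR]
    push_cast
    have := Int.floor_le (K * (y + k * η))
    have e : 1 / K * K = 1 := by field_simp
    linarith
  obtain ⟨h1, h2⟩ := abs_le.mp hjα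
  have e : j * (α - 1 / K) = j * α - j / K := by ring
  rw [e, hjR] at h1 h2
  constructor <;> linarith


/-! ### Occurrence counts, prefixes and suffixes. -/

lemma occ_nil {w : Word} : occ w [] = 0 := by simp [occ]

lemma occ_cons (w : Word) (c : Fin 2) (u : Word) :
    occ w (c :: u) = (if w <+: c :: u then 1 else 0) + occ w u := by
  simp only [occ, List.length_cons, Finset.range_eq_Ico, Finset.card_filter]
  rw [Finset.sum_eq_sum_Ico_succ_bot (by omega), Finset.sum_Ico_add' _ 0 _ 1 |>.symm]
  simp

/-- Every occurrence of w is preceded by exactly one letter unless it starts the word. Thus counts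
of words of length at most k determine the prefixes of length less than k. -/
lemma occ_eq_prefix_add {w : Word} (hw : w ≠ []) (u : Word) :
    occ w u = (if w <+: u then 1 else 0) + ∑ a : Fin 2, occ (a :: w) u := by
  induction u with
  | nil => simp [occ_nil, hw]
  | cons c u ih =>
    simp only [occ_cons, Finset.sum_add_distrib]
    rw [ih]
    have : ∑ a : Fin 2, (if a :: w <+: c :: u then 1 else 0) = if w <+: u then 1 else 0 := by
      by_cases h : w <+: u <;> simp [List.cons_prefix_cons, h]
    rw [this]

lemma prefix_indicator (w u : Word) :
    (if w <+: u then 1 else 0) = (if w = u then 1 else 0) +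
      ∑ a : Fin 2, (if w ++ [a] <+: u then 1 else 0) := by
  by_cases h : w <+: u
  · obtain ⟨v, rfl⟩ := h
    cases v with
    | nil =>
      have h2 : ∀ a, ¬ w ++ [a] <+: w := fun a ha => by simpa using ha.length_le
      simp [h2]
    | cons b v => simp [List.prefix_append_right_inj, List.cons_prefix_cons]
  · have h1 : w ≠ u := by rintro rfl; exact h (List.prefix_refl _)
    have h2 : ∀ a, ¬ w ++ [a] <+: u := fun a ha => h ((List.prefix_append w [a]).trans ha)
    simp [h, h1, h2]

lemma occ_eq_suffix_add {w : Word} (hw : w ≠ []) (u : Word) :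
    occ w u = (if w <:+ u then 1 else 0) + ∑ a : Fin 2, occ (w ++ [a]) u := by
  induction u with
  | nil => simp [occ_nil, hw]
  | cons c u ih =>
    simp only [occ_cons, Finset.sum_add_distrib]
    rw [ih, prefix_indicator w (c :: u)]
    have : (if w <:+ c :: u then 1 else 0) =
        (if w = c :: u then 1 else 0) + if w <:+ u then 1 else 0 := by
      simp only [List.suffix_cons_iff]
      by_cases h : w = c :: u
      · subst h
        have : ¬ (c :: u) <:+ u := fun h => by simpa using h.length_le
        simp [this]
      · simp [h]
    rw [this]
    ring

lemma KAbelianEquiv.prefix_iff {k : ℕ} {u v : Word} (h : KAbelianEquiv k u v) {w : Word}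
    (hw : w.length < k) : w <+: u ↔ w <+: v := by
  by_cases hw0 : w = []
  · simp [hw0]
  have h1 := occ_eq_prefix_add hw0 u
  rw [h w hw0 hw.le, occ_eq_prefix_add hw0 v,
    Finset.sum_congr rfl fun a _ => h (a :: w) (by simp) (by simpa using hw)] at h1
  by_cases hu : w <+: u <;> by_cases hv : w <+: v <;> simp_all

lemma KAbelianEquiv.suffix_iff {k : ℕ} {u v : Word} (h : KAbelianEquiv k u v) {w : Word}
    (hw : w.length < k) : w <:+ u ↔ w <:+ v := by
  by_cases hw0 : w = []
  · simp [hw0]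
  have h1 := occ_eq_suffix_add hw0 u
  rw [h w hw0 hw.le, occ_eq_suffix_add hw0 v,
    Finset.sum_congr rfl fun a _ => h (w ++ [a]) (by simp) (by simpa using hw)] at h1
  by_cases hu : w <:+ u <;> by_cases hv : w <:+ v <;> simp_all

lemma KAbelianEquiv.take_eq {k : ℕ} {u v : Word} (h : KAbelianEquiv k u v)
    (hlen : u.length = v.length) {t : ℕ} (ht : t < k) : u.take t = v.take t := by
  have h1 : u.take t <+: v :=
    (h.prefix_iff ((List.length_take_le t u).trans_lt ht)).mp (List.take_prefix t u)
  rw [List.prefix_iff_eq_take] at h1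
  rw [h1, List.length_take, hlen]
  by_cases h2 : t ≤ v.length
  · rw [min_eq_left h2]
  · rw [min_eq_right (by omega), List.take_length, List.take_of_length_le (by omega)]

lemma KAbelianEquiv.drop_eq {k : ℕ} {u v : Word} (h : KAbelianEquiv k u v)
    (hlen : u.length = v.length) {t : ℕ} (ht : u.length < t + k) : u.drop t = v.drop t := by
  rcases le_total u.length t with h0 | h0
  · rw [List.drop_of_length_le h0, List.drop_of_length_le (by omega)]
  have h1 : u.drop t <:+ v :=
    (h.suffix_iff (by rw [List.length_drop]; omega)).mp (List.drop_suffix t u)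
  rw [List.suffix_iff_eq_drop] at h1
  rw [h1, List.length_drop, hlen]
  congr 1
  omega

lemma occ_singleton_one (u : Word) : occ [1] u = (u.map Fin.val).sum := by
  induction u with
  | nil => simp [occ_nil]
  | cons c u ih =>
    rw [occ_cons, ih]
    fin_cases c <;> simp [List.cons_prefix_cons]

/-! ### Sturmian letters as increments of the floor or ceiling along the rotation. -/

/-- An integer-valued function that behaves like the floor or the ceiling function. -/
structure IsRounding (Φ : ℝ → ℤ) : Prop where
  add_int : ∀ (z : ℝ) (p : ℤ), Φ (z + p) = Φ z + p
  lt_of_lt_of_lt : ∀ {y z : ℝ} {q : ℤ}, y < q → q < z → Φ y < Φ z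
  abs_sub_lt : ∀ y z : ℝ, |(Φ y - Φ z : ℝ) - (y - z)| < 1

lemma isRounding_floor : IsRounding Int.floor where
  add_int z p := Int.floor_add_intCast z p
  lt_of_lt_of_lt h1 h2 := (Int.floor_lt.mpr h1).trans_le (Int.le_floor.mpr h2.le)
  abs_sub_lt y z := by
    have h1 := Int.floor_le y
    have h2 := Int.lt_floor_add_one y
    have h3 := Int.floor_le z
    have h4 := Int.lt_floor_add_one z
    rw [abs_lt]; constructor <;> linarith

lemma isRounding_ceil : IsRounding Int.ceil where
  add_int z p := Int.ceil_add_intCast z p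
  lt_of_lt_of_lt h1 h2 := (Int.ceil_le.mpr h1.le).trans_lt (Int.lt_ceil.mpr h2)
  abs_sub_lt y z := by
    have h1 := Int.le_ceil y
    have h2 := Int.ceil_lt_add_one y
    have h3 := Int.le_ceil z
    have h4 := Int.ceil_lt_add_one z
    rw [abs_lt]; constructor <;> linarith

lemma fract_one_sub {α : ℝ} (hα : Irrational α) : Int.fract (1 - α) = 1 - Int.fract α := by
  rw [sub_eq_add_neg, add_comm, Int.fract_add_one, Int.fract_neg]
  intro h
  exact hα.ne_int ⌊α⌋ (by have := Int.self_sub_floor α; linarith)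

lemma lowerSturmian_eq {α : ℝ} (hα : Irrational α) (x : ℝ) (n : ℕ) :
    ((lowerSturmian α x n : ℕ) : ℤ) = ⌊x + (n + 1 : ℕ) * α⌋ - ⌊x + n * α⌋ - ⌊α⌋ := by
  rw [lowerSturmian, fract_one_sub hα]
  have e : x + (n + 1 : ℕ) * α = (x + n * α) + α := by push_cast; ring
  rw [e]
  set z := x + n * α
  have h1 := Int.floor_add_fract z
  have h2 := Int.floor_add_fract α
  have h3 := Int.fract_nonneg z
  have h4 := Int.fract_lt_one z
  have h5 := Int.fract_nonneg α
  have h6 := Int.fract_lt_one α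
  split_ifs with h
  · have : ⌊z + α⌋ = ⌊z⌋ + ⌊α⌋ := by
      rw [Int.floor_eq_iff]; push_cast; constructor <;> linarith
    rw [this]; simp
  · have : ⌊z + α⌋ = ⌊z⌋ + ⌊α⌋ + 1 := by
      rw [Int.floor_eq_iff]; push_cast; constructor <;> linarith
    rw [this]; simp; ring

lemma upperSturmian_eq {α : ℝ} (hα : Irrational α) (x : ℝ) (n : ℕ) :
    ((upperSturmian α x n : ℕ) : ℤ) = ⌈x + (n + 1 : ℕ) * α⌉ - ⌈x + n * α⌉ - ⌊α⌋ := by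
  rw [upperSturmian, fract_one_sub hα]
  have e : x + (n + 1 : ℕ) * α = (x + n * α) + α := by push_cast; ring
  rw [e]
  set z := x + n * α
  have h1 := Int.floor_add_fract z
  have h2 := Int.floor_add_fract α
  have h3 := Int.fract_nonneg z
  have h4 := Int.fract_lt_one z
  have h5 : 0 < Int.fract α := by
    refine lt_of_le_of_ne (Int.fract_nonneg α) fun h => hα.ne_int ⌊α⌋ (by linarith)
  have h6 := Int.fract_lt_one α
  rcases h3.eq_or_lt with h0 | h0
  · rw [← h0]
    have hz : ⌈z⌉ = ⌊z⌋ := by rw [Int.ceil_eq_iff]; constructor <;> linarith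
    have : ⌈z + α⌉ = ⌊z⌋ + ⌊α⌋ + 1 := by
      rw [Int.ceil_eq_iff]; push_cast; constructor <;> linarith
    rw [this, hz]; simp; ring
  · have hz : ⌈z⌉ = ⌊z⌋ + 1 := by rw [Int.ceil_eq_iff]; push_cast; constructor <;> linarith
    rw [hz]
    split_ifs with h
    · have : ⌈z + α⌉ = ⌊z⌋ + ⌊α⌋ + 1 := by
        rw [Int.ceil_eq_iff]; push_cast; constructor <;> linarith
      rw [this]; simp
    · have h' : 1 - Int.fract α < Int.fract z := by
        by_contra! hc; exact h ⟨h0, hc⟩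
      have : ⌈z + α⌉ = ⌊z⌋ + ⌊α⌋ + 2 := by
        rw [Int.ceil_eq_iff]; push_cast; constructor <;> linarith
      rw [this]; simp; ring

lemma IsSturmian.exists_rounding {α : ℝ} (hα : Irrational α) {s : ℕ → Fin 2}
    (hs : IsSturmian α s) : ∃ Φ, IsRounding Φ ∧ ∃ x : ℝ, ∀ n : ℕ,
      ((s n : ℕ) : ℤ) = Φ (x + (n + 1 : ℕ) * α) - Φ (x + n * α) - ⌊α⌋ := by
  obtain ⟨x, -, rfl | rfl⟩ := hs
  · exact ⟨_, isRounding_floor, x, lowerSturmian_eq hα x⟩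
  · exact ⟨_, isRounding_ceil, x, upperSturmian_eq hα x⟩


/-! ### Factors of Sturmian words. -/

lemma sum_range_letters {s : ℕ → Fin 2} {F : ℕ → ℤ} {c : ℤ}
    (hs : ∀ n, ((s n : ℕ) : ℤ) = F (n + 1) - F n - c) (i m : ℕ) :
    ∑ j ∈ Finset.range m, ((s (i + j) : ℕ) : ℤ) = F (i + m) - F i - m * c := by
  induction m with
  | zero => simp
  | succ m ih => rw [Finset.sum_range_succ, ih, hs, ← add_assoc]; push_cast; ring

/-- The factor of length `m` of `s` at position `i`. -/
def factor (s : ℕ → Fin 2) (i m : ℕ) : Word := List.ofFn fun j : Fin m => s (i + j)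

@[simp] lemma length_factor (s : ℕ → Fin 2) (i m : ℕ) : (factor s i m).length = m := by
  simp [factor]

lemma sum_factor (s : ℕ → Fin 2) (i m : ℕ) :
    ((factor s i m).map Fin.val).sum = ∑ j ∈ Finset.range m, (s (i + j) : ℕ) := by
  rw [factor, List.map_ofFn, List.sum_ofFn, Finset.sum_range]
  rfl

lemma flatten_factor (s : ℕ → Fin 2) (i n m : ℕ) :
    (List.ofFn fun l : Fin n => factor s (i + l * m) m).flatten = factor s i (n * m) := by
  rw [factor, List.ofFn_mul]
  simp [factor, add_assoc]

lemma occursIn_iff {u : Word} {s : ℕ → Fin 2} :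
    OccursIn u s ↔ ∃ i, u = factor s i u.length := by
  refine exists_congr fun i => ⟨fun h => ?_, fun h j => ?_⟩
  · refine List.ext_get (by simp) fun j h1 h2 => ?_
    rw [h ⟨j, h1⟩]; simp [factor]
  · rw [List.get_eq_getElem, List.getElem_of_eq h]; simp [factor]

/-- A `k`-abelian power in `s` yields consecutive equivalent factors of `s`. -/
lemma exists_kAbelianEquiv_factor {k n m : ℕ} {u : Word} {s : ℕ → Fin 2} (hu : OccursIn u s)
    (hp : IsKAbelianPower k n m u) :
    ∃ i, ∀ l l' : ℕ, l < n → l' < n →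
      KAbelianEquiv k (factor s (i + l * m) m) (factor s (i + l' * m) m) := by
  obtain ⟨v, hv, heq, rfl⟩ := hp
  obtain ⟨i, hi⟩ := occursIn_iff.mp hu
  refine ⟨i, ?_⟩
  have hlen : (List.ofFn v).flatten.length = n * m := by
    rw [List.length_flatten, List.map_ofFn, List.sum_ofFn]
    simp [hv]
  rw [hlen, ← flatten_factor] at hi
  have h := List.eq_iff_flatten_eq.mpr ⟨hi, by
    rw [List.map_ofFn, List.map_ofFn]; congr 1; funext l; simp [hv]⟩
  have hvl := List.ofFn_injective h
  intro l l' hl hl'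
  have := heq ⟨l, hl⟩ ⟨l', hl'⟩
  rwa [hvl] at this

lemma take_factor (s : ℕ → Fin 2) (i : ℕ) {j m : ℕ} (hj : j ≤ m) :
    (factor s i m).take j = factor s i j :=
  List.ext_getElem (by simpa using hj) fun l _ _ => by simp [factor]

lemma drop_factor (s : ℕ → Fin 2) (i j m : ℕ) :
    (factor s i m).drop j = factor s (i + j) (m - j) :=
  List.ext_getElem (by simp) fun l _ _ => by simp [factor, add_assoc]

lemma sub_eq_of_factor_eq {s : ℕ → Fin 2} {F : ℕ → ℤ} {c : ℤ}
    (hs : ∀ n, ((s n : ℕ) : ℤ) = F (n + 1) - F n - c) {i i' m : ℕ}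
    (h : ((factor s i m).map Fin.val).sum = ((factor s i' m).map Fin.val).sum) :
    F (i + m) - F i = F (i' + m) - F i' := by
  rw [sum_factor, sum_factor] at h
  have h2 := sum_range_letters hs i m
  have h3 := sum_range_letters hs i' m
  zify at h
  linarith

/-! ### Upper bound for exponents. -/

/-- The run of rotation points that belongs to a `k`-abelian power avoids the points `-jα`,
`|j| < k`, apart from its two ends. -/
lemma IsRounding.mul_abs_le {Φ : ℝ → ℤ} (hΦ : IsRounding Φ) {s : ℕ → Fin 2} {α x η : ℝ} {c : ℤ}
    (hs : ∀ n : ℕ, ((s n : ℕ) : ℤ) = Φ (x + (n + 1 : ℕ) * α) - Φ (x + n * α) - c)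
    {k m n i : ℕ} (hk : 1 < k) (hm : k ≤ m) (hα : |α - 1 / (2 * (k : ℝ) - 1)| ≤ η)
    (heq : ∀ l l' : ℕ, l < n → l' < n →
      KAbelianEquiv k (factor s (i + l * m) m) (factor s (i + l' * m) m))
    {p : ℤ} (hp : |m * α - p| ≤ 1 / 2) :
    ((n : ℝ) - 2) * |m * α - p| ≤ 1 / (2 * (k : ℝ) - 1) + 2 * k * η := by
  have hη : 0 ≤ η := (abs_nonneg _).trans hα
  have hk' : (2 : ℝ) ≤ k := by exact_mod_cast hk
  have hr : 0 ≤ 1 / (2 * (k : ℝ) - 1) + 2 * k * η :=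
    add_nonneg (div_nonneg zero_le_one (by linarith)) (by positivity)
  rcases le_or_gt n 2 with hn | hn
  · refine le_trans (mul_nonpos_of_nonpos_of_nonneg ?_ (abs_nonneg _)) hr
    have : (n : ℝ) ≤ 2 := by exact_mod_cast hn
    linarith
  obtain ⟨r, rfl⟩ : ∃ r, n = r + 3 := ⟨n - 3, by omega⟩
  set ε := m * α - p with hε
  let F : ℕ → ℤ := fun N => Φ (x + N * α)
  have hsF : ∀ n : ℕ, ((s n : ℕ) : ℤ) = F (n + 1) - F n - c := hs
  let Y : ℕ → ℝ := fun l => x + i * α + l * ε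
  have hF : ∀ l j : ℕ, F (i + l * m + j) = Φ (Y l + j * α) + l * p := by
    intro l j
    have e : x + (i + l * m + j : ℕ) * α = (Y l + j * α) + (l * p : ℤ) := by
      simp only [Y, hε]; push_cast; ring
    simp only [F]
    rw [e, hΦ.add_int]
  have hF' : ∀ l j : ℕ, j ≤ m → F (i + l * m + (m - j)) = Φ (Y (l + 1) - j * α) + (l + 1) * p := by
    intro l j hj
    have e : x + (i + l * m + (m - j) : ℕ) * α = (Y (l + 1) - j * α) + ((l + 1) * p : ℤ) := by
      simp only [Y, hε]; push_cast [Nat.cast_sub hj]; ring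
    simp only [F]
    rw [e, hΦ.add_int]
  have hstep : ∀ l < r + 3, Φ (Y (l + 1)) - Φ (Y l) = Φ (Y 1) - Φ (Y 0) := by
    intro l hl
    have h1 := heq l 0 hl (by omega) [1] (by simp) (by simpa using hk.le)
    rw [occ_singleton_one, occ_singleton_one] at h1
    have h2 := sub_eq_of_factor_eq hsF h1
    have h3 := hF' l 0 (by omega)
    have h4 := hF l 0
    have h5 := hF' 0 0 (by omega)
    have h6 := hF 0 0
    simp only [Nat.sub_zero, Nat.cast_zero, zero_mul, sub_zero, add_zero, zero_add] at *
    linarith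
  -- Two steps change Φ by twice this integer while the point moves by at most 1 in absolute value;
  -- the rounding error is below 1, so the integer is 0.
  have hC : Φ (Y 1) - Φ (Y 0) = 0 := by
    have h1 := hstep 1 (by omega)
    have h2 := hΦ.abs_sub_lt (Y 2) (Y 0)
    have h3 : Y 2 - Y 0 = 2 * ε := by simp only [Y]; push_cast; ring
    have h4 : Φ (Y 2) - Φ (Y 0) = 2 * (Φ (Y 1) - Φ (Y 0)) := by
      norm_num at h1; linarith
    have h5 : ((Φ (Y 2) : ℝ) - Φ (Y 0)) = 2 * ((Φ (Y 1) - Φ (Y 0) : ℤ) : ℝ) := by exact_mod_cast h4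
    rw [h5, h3, abs_lt] at h2
    obtain ⟨h6, h7⟩ := abs_le.mp hp
    have h8 : ((Φ (Y 1) - Φ (Y 0) : ℤ) : ℝ) < (1 : ℤ) := by push_cast at h2 ⊢; linarith [h2.2]
    have h9 : ((-1 : ℤ) : ℝ) < ((Φ (Y 1) - Φ (Y 0) : ℤ) : ℝ) := by push_cast at h2 ⊢; linarith [h2.1]
    rw [Int.cast_lt] at h8 h9
    omega
  have hconst : ∀ l ≤ r + 3, Φ (Y l) = Φ (Y 0) := by
    intro l hl
    induction l with
    | zero => rfl
    | succ l ih =>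
      have := hstep l (by omega)
      rw [hC, ih (by omega)] at this
      linarith
  -- `Y 1` and `Y (r + 2)` are starts of blocks 1 and r + 2 and also ends of blocks 0 and r + 1.
  -- Prefixes control the translates by jα and suffixes those by -jα; needing both costs two steps,
  -- hence n - 2.
  have hpos : ∀ j : ℕ, j < k → Φ (Y 1 + j * α) = Φ (Y (r + 2) + j * α) := by
    intro j hj
    have h1 := (heq 1 (r + 2) (by omega) (by omega)).take_eq (by simp) hj
    rw [take_factor s _ (by omega), take_factor s _ (by omega)] at h1
    have h2 := sub_eq_of_factor_eq hsF (congrArg (fun u : Word => (u.map Fin.val).sum) h1)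
    have h3 := hF 1 0
    have h4 := hF (r + 2) 0
    have h5 := hconst 1 (by omega)
    have h6 := hconst (r + 2) (by omega)
    rw [hF, hF] at h2
    simp only [Nat.cast_zero, zero_mul, add_zero] at h3 h4
    rw [h3, h4] at h2
    linarith
  have hneg : ∀ j : ℕ, j < k → Φ (Y 1 - j * α) = Φ (Y (r + 2) - j * α) := by
    intro j hj
    have h1 := (heq 0 (r + 1) (by omega) (by omega)).drop_eq (by simp) (t := m - j)
      (by simp; omega)
    rw [drop_factor, drop_factor] at h1
    have h2 := sub_eq_of_factor_eq hsF (congrArg (fun u : Word => (u.map Fin.val).sum) h1)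
    have e : ∀ l, i + l * m + (m - j) + (m - (m - j)) = i + (l + 1) * m + 0 := by
      intro l
      rw [add_one_mul]; omega
    rw [e, e, hF' 0 j (by omega), hF' (r + 1) j (by omega), hF, hF] at h2
    have h5 := hconst 1 (by omega)
    have h6 := hconst (r + 2) (by omega)
    simp only [Nat.cast_zero, zero_mul, add_zero, zero_add] at h2
    rw [h5, show r + 1 + 1 = r + 2 from rfl, h6] at h2
    push_cast at h2
    linarith
  have hall : ∀ j : ℤ, |j| < k → Φ (Y 1 + j * α) = Φ (Y (r + 2) + j * α) := by
    intro j hj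
    obtain ⟨a, rfl | rfl⟩ := j.eq_nat_or_neg
    · simpa using hpos a (by simpa using hj)
    · have := hneg a (by simpa using hj)
      simpa [← sub_eq_add_neg] using this
  have hdiff : Y (r + 2) - Y 1 = (((r + 3 : ℕ) : ℝ) - 2) * ε := by
    simp only [Y]; push_cast; ring
  by_contra! hcon
  rcases abs_cases ε with ⟨ha, -⟩ | ⟨ha, -⟩
  · rw [ha, ← hdiff] at hcon
    obtain ⟨j, q, hj, h1, h2⟩ := exists_int_between hk hα hcon
    exact (hΦ.lt_of_lt_of_lt h1 h2).ne (hall j hj)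
  · rw [ha, mul_neg, ← hdiff, neg_sub] at hcon
    obtain ⟨j, q, hj, h1, h2⟩ := exists_int_between hk hα hcon
    exact (hΦ.lt_of_lt_of_lt h1 h2).ne' (hall j hj)


/-! ### Slopes with critical exponent close to √5 / (2k - 1). -/

lemma exists_criticalExponent_le {k : ℕ} (hk : 1 < k) {η : ℝ} (hη : 0 < η) :
    ∃ α, Irrational α ∧
      criticalExponent k α ≤ ENNReal.ofReal (√5 / (2 * (k : ℝ) - 1) + η) := by
  have hk' : (2 : ℝ) ≤ k := by exact_mod_cast hk
  have hK0 : 0 < 2 * (k : ℝ) - 1 := by linarith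
  set c := √5 / (2 * (k : ℝ) - 1) + η with hc
  have hc0 : 0 < c := by positivity
  obtain ⟨τ, hτ, hτ0⟩ : ∃ τ : ℝ, (1 / (2 * (k : ℝ) - 1) + 2 * k * τ) * (√5 + τ) < c ∧ 0 < τ := by
    have hcont : Continuous fun τ : ℝ => (1 / (2 * (k : ℝ) - 1) + 2 * k * τ) * (√5 + τ) := by
      fun_prop
    have h0 : (fun τ : ℝ => (1 / (2 * (k : ℝ) - 1) + 2 * k * τ) * (√5 + τ)) 0 < c := by
      simp only [mul_zero, add_zero, hc]
      rw [one_div_mul_eq_div]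
      linarith
    have h1 := hcont.continuousAt.eventually_lt_const h0
    obtain ⟨τ, h2, h3⟩ := ((eventually_nhdsWithin_of_eventually_nhds h1).and
      (self_mem_nhdsWithin (s := Set.Ioi (0 : ℝ)))).exists
    exact ⟨τ, h2, h3⟩
  obtain ⟨A, B, C, α, hdisc, hroot, hα⟩ := exists_discrim_eq_five (2 * k - 1) (by omega) hτ0
  rw [Nat.cast_sub (by omega)] at hα
  push_cast at hα
  have hirr := irrational_of_discrim_eq_five hdisc hroot
  refine ⟨α, hirr, Filter.limsup_le_of_le (by isBoundedDefault) ?_⟩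
  set L := 1 / (2 * (k : ℝ) - 1) + 2 * k * τ with hL
  have hL0 : 0 ≤ L := by positivity
  set r := √5 + τ with hr
  have hr0 : 0 ≤ r := by positivity
  -- From (n - 2)·e ≤ L and 1 < r·m·e follows n ≤ L·r·m + 2; for m beyond M the 2 is absorbed into
  -- c·m.
  obtain ⟨M, hM⟩ := exists_nat_gt (2 / (c - L * r))
  filter_upwards [eventually_of_discrim_eq_five hdisc hroot (r := r) (by linarith),
    Filter.eventually_ge_atTop M, Filter.eventually_ge_atTop k] with m hm hmM hmk
  have hmM' : 2 / (c - L * r) < m := hM.trans_le (by exact_mod_cast hmM)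
  rw [div_lt_iff₀ (by linarith)] at hmM'
  apply ENNReal.div_le_of_le_mul
  have hbound : maxExponent k α m ≤ ((⌊c * m⌋₊ : ℕ) : ℕ∞) := by
    refine iSup₂_le fun n hn => ?_
    obtain ⟨-, u, s, hs, hu, hp⟩ := hn
    obtain ⟨i, hi⟩ := exists_kAbelianEquiv_factor hu hp
    obtain ⟨Φ, hΦ, x, hx⟩ := hs.exists_rounding hirr
    have h1 := hΦ.mul_abs_le hx hk hmk hα.le hi (abs_sub_round (m * α))
    have h2 := hm (round (m * α))
    set e := |m * α - round (m * α)| with he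
    have he0 : 0 ≤ e := abs_nonneg _
    norm_cast
    apply Nat.le_floor
    have hrm : 0 ≤ r * m := by positivity
    have h3 : r * m * (((n : ℝ) - 2) * e) ≤ r * m * L := mul_le_mul_of_nonneg_left h1 hrm
    have h4 : (n : ℝ) - 2 ≤ r * m * L := by
      rcases le_total (n : ℝ) 2 with h | h
      · have : 0 ≤ r * m * L := by positivity
        linarith
      · nlinarith
    linarith
  calc (maxExponent k α m : ENNReal) ≤ (((⌊c * m⌋₊ : ℕ) : ℕ∞) : ENNReal) := by
        exact_mod_cast hbound
    _ = ENNReal.ofReal (⌊c * m⌋₊ : ℕ) := by simp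
    _ ≤ ENNReal.ofReal (c * m) := ENNReal.ofReal_le_ofReal (Nat.floor_le (by positivity))
    _ = ENNReal.ofReal c * m := by rw [ENNReal.ofReal_mul hc0.le, ENNReal.ofReal_natCast]


/-! ### Construction of powers from runs inside a gap. -/

open Classical in
/-- The indicator function of a cylinder of the rotation by `α` is a difference of two floors. -/
lemma cylinder_indicator (α : ℝ) (h : ℕ → ℤ) (h0 : h 0 = 0) (t : ℕ) :
    ∃ a ≤ t, ∃ b ≤ t, ∃ C : ℤ, ∀ y : ℝ,
      (if ∀ l ≤ t, ⌊y + l * α⌋ = ⌊y⌋ + h l then 1 else 0 : ℤ) =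
        ⌊y + a * α⌋ - ⌊y + b * α⌋ + C := by
  let g : ℕ → ℝ := fun l => h l - l * α
  obtain ⟨a, ha, hamax⟩ := Finset.exists_max_image (Finset.range (t + 1)) g ⟨0, by simp⟩
  obtain ⟨b, hb, hbmin⟩ := Finset.exists_min_image (Finset.range (t + 1)) g ⟨0, by simp⟩
  simp only [Finset.mem_range, Nat.lt_succ_iff] at ha hb hamax hbmin
  have hg0 : g 0 = 0 := by simp [g, h0]
  have ga : 0 ≤ g a := hg0 ▸ hamax 0 (Nat.zero_le t)
  have gb : g b ≤ 0 := hg0 ▸ hbmin 0 (Nat.zero_le t)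
  -- The cylinder is an interval cut out by its largest lower and smallest upper constraint. The
  -- floors at y + aα and y + bα jump at its two ends.
  have hiff : ∀ y : ℝ, (∀ l ≤ t, ⌊y + l * α⌋ = ⌊y⌋ + h l) ↔
      g a ≤ Int.fract y ∧ Int.fract y < g b + 1 := by
    intro y
    have hy := Int.floor_add_fract y
    constructor
    · intro H
      have h1 := (Int.floor_eq_iff.mp (H a ha)).1
      have h2 := (Int.floor_eq_iff.mp (H b hb)).2
      push_cast at h1 h2
      constructor <;> simp only [g] <;> linarith
    · rintro ⟨h1, h2⟩ l hl
      have h3 := hamax l hl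
      have h4 := hbmin l hl
      rw [Int.floor_eq_iff]
      simp only [g] at *
      push_cast
      constructor <;> linarith
  by_cases hab : g a < g b + 1
  · refine ⟨a, ha, b, hb, h b - h a + 1, fun y => ?_⟩
    have hy := Int.floor_add_fract y
    have hy0 := Int.fract_nonneg y
    have hy1 := Int.fract_lt_one y
    have hA : ⌊y + a * α⌋ = ⌊y⌋ + h a + if g a ≤ Int.fract y then 0 else -1 := by
      split_ifs with hc <;> rw [Int.floor_eq_iff] <;> simp only [g] at * <;> push_cast <;>
        constructor <;> linarith
    have hB : ⌊y + b * α⌋ = ⌊y⌋ + h b + if Int.fract y < g b + 1 then 0 else 1 := by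
      split_ifs with hc <;> rw [Int.floor_eq_iff] <;> simp only [g] at * <;> push_cast <;>
        constructor <;> linarith
    rw [hA, hB]
    simp only [hiff]
    by_cases c1 : g a ≤ Int.fract y <;> by_cases c2 : Int.fract y < g b + 1
    · simp [c1, c2]; ring
    · simp [c1, c2]; ring
    · simp [c1, c2]; ring
    · exfalso; linarith
  · refine ⟨0, Nat.zero_le t, 0, Nat.zero_le t, 0, fun y => ?_⟩
    simp only [hiff, sub_self, add_zero]
    rw [if_neg]
    rintro ⟨h1, h2⟩
    linarith

/-- The sequence d vanishes at the k positions at either end of [0, m], so a window that omits at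
most k of them there has the full sum. -/
lemma sum_range_shift_eq {d : ℕ → ℤ} {k m M t a : ℕ} (hM : M + t = m + 1) (htk : t ≤ k)
    (ha : a ≤ t) (hd : ∀ j < k, d j = 0) (hd' : ∀ j ≤ m, m < j + k → d j = 0) :
    ∑ j ∈ Finset.range M, d (j + a) = ∑ j ∈ Finset.range (m + 1), d j := by
  obtain ⟨b, rfl⟩ := Nat.exists_eq_add_of_le ha
  rw [← hM, show M + (a + b) = a + M + b by ring, Finset.sum_range_add, Finset.sum_range_add,
    Finset.sum_eq_zero (s := Finset.range a), Finset.sum_eq_zero (s := Finset.range b), zero_add,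
    add_zero]
  · simp only [add_comm]
  · intro j hj
    have := Finset.mem_range.mp hj
    exact hd' _ (by omega) (by omega)
  · intro j hj
    have := Finset.mem_range.mp hj
    exact hd _ (by omega)

lemma eq_factor_iff {s : ℕ → Fin 2} {F : ℕ → ℤ} {c : ℤ}
    (hs : ∀ n, ((s n : ℕ) : ℤ) = F (n + 1) - F n - c) (w : Word) (q : ℕ) :
    w = factor s q w.length ↔
      ∀ l ≤ w.length, F (q + l) = F q + (((w.map Fin.val).take l).sum + l * c) := by
  constructor
  · intro h l hl
    have h1 : (w.map Fin.val).take l = (factor s q l).map Fin.val := by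
      rw [← List.map_take, ← take_factor s q hl, ← h]
    rw [h1, sum_factor]
    have := sum_range_letters hs q l
    push_cast
    linarith
  · intro h
    refine List.ext_getElem (by simp) fun l h1 h2 => ?_
    have h3 := h l (by omega)
    have h4 := h (l + 1) (by omega)
    rw [List.sum_take_succ _ l (by simpa using h1)] at h4
    have h5 := hs (q + l)
    simp only [factor, List.getElem_ofFn]
    rw [← add_assoc] at h4
    rw [h4, h3] at h5
    simp only [List.getElem_map] at h5
    push_cast at h5
    apply Fin.ext
    zify
    linarith

open Classical in
lemma occ_factor {s : ℕ → Fin 2} (w : Word) (hw : w ≠ []) (i m : ℕ) :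
    occ w (factor s i m) =
      ∑ j ∈ Finset.range (m + 1 - w.length), if w = factor s (i + j) w.length then 1 else 0 := by
  rw [occ, length_factor, Finset.card_filter]
  have hlen := List.length_pos_of_ne_nil hw
  have hiff : ∀ j, w <+: (factor s i m).drop j ↔
      j < m + 1 - w.length ∧ w = factor s (i + j) w.length := by
    intro j
    rw [drop_factor]
    constructor
    · intro h
      have h1 := h.length_le
      rw [length_factor] at h1
      rw [List.prefix_iff_eq_take, take_factor _ _ h1] at h
      exact ⟨by omega, h⟩
    · rintro ⟨h1, h2⟩
      rwa [List.prefix_iff_eq_take, take_factor _ _ (by omega)]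
  simp only [hiff]
  rw [← Finset.sum_subset (Finset.range_subset_range.mpr (by omega : m + 1 - w.length ≤ m))]
  · refine Finset.sum_congr rfl fun j hj => ?_
    simp [Finset.mem_range.mp hj]
  · intro j _ hj
    rw [Finset.mem_range] at hj
    simp [hj]

/-- Two factors are `k`-abelian equivalent if the floors at their first and last `k` positions
differ by the same constant. -/
lemma kAbelianEquiv_factor {s : ℕ → Fin 2} {α x : ℝ} {c : ℤ}
    (hs : ∀ n : ℕ, ((s n : ℕ) : ℤ) = ⌊x + (n + 1 : ℕ) * α⌋ - ⌊x + n * α⌋ - c) {k m i i' : ℕ} {e : ℤ}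
    (hpre : ∀ j < k, ⌊x + (i' + j : ℕ) * α⌋ = ⌊x + (i + j : ℕ) * α⌋ + e)
    (hsuf : ∀ j ≤ m, m < j + k → ⌊x + (i' + j : ℕ) * α⌋ = ⌊x + (i + j : ℕ) * α⌋ + e) :
    KAbelianEquiv k (factor s i m) (factor s i' m) := by
  classical
  intro w hw hwk
  rw [occ_factor w hw, occ_factor w hw]
  rcases le_or_gt w.length m with hwm | hwm
  swap
  · rw [Nat.sub_eq_zero_of_le (by omega)]; simp
  obtain ⟨M, hM⟩ : ∃ M, M + w.length = m + 1 := ⟨m + 1 - w.length, by omega⟩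
  rw [show m + 1 - w.length = M by omega]
  obtain ⟨a, ha, b, hb, C, hind⟩ := cylinder_indicator α
    (fun l => ((w.map Fin.val).take l).sum + l * c) (by simp) w.length
  have hterm : ∀ q : ℕ, (if w = factor s q w.length then 1 else 0 : ℤ) =
      ⌊x + (q + a : ℕ) * α⌋ - ⌊x + (q + b : ℕ) * α⌋ + C := by
    intro q
    have h1 := hind (x + q * α)
    have h2 : ∀ l : ℕ, x + (q + l : ℕ) * α = x + q * α + l * α := by
      intro l; push_cast; ring
    rw [h2, h2, ← h1]
    simp only [eq_factor_iff (F := fun n => ⌊x + n * α⌋) hs, h2]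
  zify
  simp only [hterm]
  let d : ℕ → ℤ := fun j => ⌊x + (i' + j : ℕ) * α⌋ - ⌊x + (i + j : ℕ) * α⌋ - e
  have hd : ∀ j < k, d j = 0 := fun j hj => by simp only [d]; rw [hpre j hj]; ring
  have hd' : ∀ j ≤ m, m < j + k → d j = 0 := fun j hj hj' => by
    simp only [d]; rw [hsuf j hj hj']; ring
  -- The occurrence counts differ by a sum of d shifted by a minus the same sum shifted by b, and
  -- neither shift changes the sum.
  have h1 := (sum_range_shift_eq hM hwk ha hd hd').trans (sum_range_shift_eq hM hwk hb hd hd').symm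
  rw [← sub_eq_zero, ← Finset.sum_sub_distrib] at h1 ⊢
  rw [← neg_eq_zero, ← Finset.sum_neg_distrib, ← h1]
  refine Finset.sum_congr rfl fun j _ => ?_
  simp only [d, add_assoc]
  ring

lemma lowerSturmian_fract (α x : ℝ) : lowerSturmian α (Int.fract x) = lowerSturmian α x := by
  funext n
  have : Int.fract x + n * α = x + n * α - ⌊x⌋ := by rw [Int.fract]; ring
  rw [lowerSturmian, lowerSturmian, this, Int.fract_sub_intCast]

lemma isKAbelianPower_factor {s : ℕ → Fin 2} {k n m : ℕ}
    (h : ∀ l l' : ℕ, l < n → l' < n → KAbelianEquiv k (factor s (l * m) m) (factor s (l' * m) m)) :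
    IsKAbelianPower k n m (factor s 0 (n * m)) := by
  refine ⟨fun l => factor s (l * m) m, fun l => by simp, fun l l' => h l l' l.2 l'.2, ?_⟩
  rw [← flatten_factor]
  simp

/-- A run of rotation points inside a gap between the points `-jα`, `|j| < k`, yields a
`k`-abelian power. -/
lemma mem_exponents {α a b : ℝ} (hα : Irrational α) {k m n : ℕ} (hn : 1 ≤ n)
    (hab : ∀ j : ℤ, |j| < k → ⌊a + j * α⌋ = ⌊b + j * α⌋) {p : ℤ}
    (hp : n * |m * α - p| ≤ b - a) : n ∈ exponents k α m := by
  set ε := m * α - p with hε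
  -- Start at the end of [a, b] from which steps of ε lead inwards; n blocks need n + 1 points,
  -- since the end of the last block counts too.
  obtain ⟨x, hx⟩ : ∃ x : ℝ, ∀ l : ℕ, l ≤ n → a ≤ x + l * ε ∧ x + l * ε ≤ b := by
    have hl : ∀ l : ℕ, l ≤ n → l * |ε| ≤ b - a := fun l hl =>
      (mul_le_mul_of_nonneg_right (by exact_mod_cast hl) (abs_nonneg _)).trans hp
    have h0 : ∀ l : ℕ, 0 ≤ l * |ε| := fun l => by positivity
    rcases abs_cases ε with ⟨he, -⟩ | ⟨he, -⟩
    · refine ⟨a, fun l hln => ?_⟩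
      have h1 := hl l hln
      have h2 := h0 l
      rw [he] at h1 h2
      constructor <;> linarith
    · refine ⟨b, fun l hln => ?_⟩
      have h1 := hl l hln
      have h2 := h0 l
      rw [he] at h1 h2
      constructor <;> linarith
  have hfl : ∀ l ≤ n, ∀ j : ℤ, |j| < k → ⌊x + l * ε + j * α⌋ = ⌊a + j * α⌋ := by
    intro l hl j hj
    obtain ⟨h1, h2⟩ := hx l hl
    refine le_antisymm ?_ (Int.floor_le_floor (by linarith))
    rw [hab j hj]
    exact Int.floor_le_floor (by linarith)
  have hs := lowerSturmian_eq hα x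
  refine ⟨hn, factor (lowerSturmian α x) 0 (n * m), lowerSturmian α x,
    ⟨Int.fract x, ⟨Int.fract_nonneg x, Int.fract_lt_one x⟩, Or.inl (lowerSturmian_fract α x).symm⟩,
    occursIn_iff.mpr ⟨0, by simp⟩, isKAbelianPower_factor fun l l' hl hl' => ?_⟩
  have hpre : ∀ l < n, ∀ j < k, ⌊x + (l * m + j : ℕ) * α⌋ = ⌊a + j * α⌋ + l * p := by
    intro l hl j hj
    have e : x + (l * m + j : ℕ) * α = x + l * ε + (j : ℤ) * α + (l * p : ℤ) := by
      rw [hε]; push_cast; ring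
    rw [e, Int.floor_add_intCast, hfl l hl.le j (by simpa using hj)]
    simp
  -- The end of block l is viewed backwards from the start of block l + 1, with shift j - m in (-k,
  -- 0].
  have hsuf : ∀ l < n, ∀ j ≤ m, m < j + k →
      ⌊x + (l * m + j : ℕ) * α⌋ = ⌊a + ((j : ℤ) - m : ℤ) * α⌋ + (l + 1) * p := by
    intro l hl j hj hj'
    have e : x + (l * m + j : ℕ) * α =
        x + (l + 1 : ℕ) * ε + ((j : ℤ) - m : ℤ) * α + ((l + 1) * p : ℤ) := by
      rw [hε]; push_cast; ring
    rw [e, Int.floor_add_intCast, hfl (l + 1) hl _ (by rw [abs_lt]; constructor <;> omega)]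
  refine kAbelianEquiv_factor hs (e := (l' - l) * p) (fun j hj => ?_) fun j hj hj' => ?_
  · rw [hpre l hl j hj, hpre l' hl' j hj]; ring
  · rw [hsuf l hl j hj hj', hsuf l' hl' j hj hj']; ring

/-! ### Lower bound for all slopes, and the accumulation point. -/

lemma exists_le_criticalExponent {α : ℝ} (hα : Irrational α) {k : ℕ} (hk : 1 < k) :
    ∃ c, √5 / (2 * (k : ℝ) - 1) < c ∧ ENNReal.ofReal c ≤ criticalExponent k α := by
  have hk' : (2 : ℝ) ≤ k := by exact_mod_cast hk
  have hK0 : 0 < 2 * (k : ℝ) - 1 := by linarith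
  obtain ⟨a, b, hlen, hab⟩ := exists_gap hα hk
  have h5 : 0 < √5 := by positivity
  have hlt : √5 / (2 * (k : ℝ) - 1) < √5 * (b - a) := by
    rw [div_eq_mul_one_div]
    exact mul_lt_mul_of_pos_left hlen h5
  obtain ⟨c, hc1, hc2⟩ := exists_between hlt
  have hc0 : 0 < c := lt_trans (by positivity) hc1
  have hba : 0 < b - a := lt_trans (by positivity) hlen
  refine ⟨c, hc1, Filter.le_limsup_of_frequently_le ?_ (by isBoundedDefault)⟩
  rw [Filter.frequently_atTop]
  intro M
  -- For m beyond this N, the slack between c·m and √5·(b - a)·m exceeds the 1 lost in rounding the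
  -- exponent down.
  obtain ⟨N, hN⟩ := exists_nat_gt (1 / (√5 * (b - a) - c))
  obtain ⟨m, hm, p, hp⟩ := hurwitz hα (max (max M 1) N)
  simp only [max_le_iff] at hm
  refine ⟨m, hm.1.1, ?_⟩
  have hm0 : (0 : ℝ) < m := by exact_mod_cast hm.1.2
  have hNm : 1 / (√5 * (b - a) - c) < m := hN.trans_le (by exact_mod_cast hm.2)
  rw [div_lt_iff₀ (by linarith)] at hNm
  have hε : 0 < |m * α - p| := by
    rw [abs_pos, sub_ne_zero]
    have := mul_ne_int hα (b := m) (by exact_mod_cast hm0.ne') p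
    simpa using this
  set e := |m * α - p| with he
  set n := ⌊(b - a) / e⌋₊ with hn
  have hne : n * e ≤ b - a := by
    rw [← le_div_iff₀ hε]
    exact Nat.floor_le (by positivity)
  have hcm : c * m ≤ n := by
    have h1 : (b - a) / e < n + 1 := Nat.lt_floor_add_one _
    have h2 : √5 * m * (b - a) ≤ (b - a) / e := by
      rw [le_div_iff₀ hε]
      have := mul_le_mul_of_nonneg_right hp.le hba.le
      linarith
    linarith
  have hn1 : 1 ≤ n := by
    have : (0 : ℝ) < n := lt_of_lt_of_le (by positivity) hcm
    exact_mod_cast this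
  have hmem := mem_exponents hα hn1 hab hne
  have hle : (n : ℕ∞) ≤ maxExponent k α m :=
    le_iSup₂ (f := fun n (_ : n ∈ exponents k α m) => (n : ℕ∞)) n hmem
  rw [ENNReal.le_div_iff_mul_le (by left; exact_mod_cast hm0.ne') (by left; simp)]
  calc ENNReal.ofReal c * m = ENNReal.ofReal (c * m) := by
        rw [ENNReal.ofReal_mul hc0.le, ENNReal.ofReal_natCast]
    _ ≤ ENNReal.ofReal (n : ℝ) := ENNReal.ofReal_le_ofReal hcm
    _ = ((n : ℕ∞) : ENNReal) := by simp
    _ ≤ maxExponent k α m := by exact_mod_cast hle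

lemma lagrangeSpectrum_subset {k : ℕ} (hk : 1 < k) :
    lagrangeSpectrum k ⊆ Set.Ioi (√5 / (2 * (k : ℝ) - 1)) := by
  rintro y ⟨α, hα, htop, rfl⟩
  obtain ⟨c, hc, hle⟩ := exists_le_criticalExponent hα hk
  exact hc.trans_le ((ENNReal.ofReal_le_iff_le_toReal htop).mp hle)

lemma accPt_lagrangeSpectrum {k : ℕ} (hk : 1 < k) :
    AccPt (√5 / (2 * (k : ℝ) - 1)) (Filter.principal (lagrangeSpectrum k)) := by
  rw [accPt_iff_nhds]
  intro U hU
  obtain ⟨η, hη, hball⟩ := Metric.mem_nhds_iff.mp hU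
  obtain ⟨α, hα, hle⟩ := exists_criticalExponent_le hk (half_pos hη)
  have htop : criticalExponent k α ≠ ⊤ := (hle.trans_lt ENNReal.ofReal_lt_top).ne
  have hmem : (criticalExponent k α).toReal ∈ lagrangeSpectrum k := ⟨α, hα, htop, rfl⟩
  have hgt := lagrangeSpectrum_subset hk hmem
  rw [Set.mem_Ioi] at hgt
  have hk' : (2 : ℝ) ≤ k := by exact_mod_cast hk
  have hK0 : 0 < 2 * (k : ℝ) - 1 := by linarith
  have hlt := ENNReal.toReal_le_of_le_ofReal (by positivity) hle
  refine ⟨_, ⟨hball ?_, hmem⟩, hgt.ne'⟩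
  rw [Metric.mem_ball, Real.dist_eq, abs_lt]
  constructor <;> linarith

end KLagrange

theorem mainTheorem3 (k : ℕ) (hk : 1 < k) :
    KLagrange.lagrangeSpectrum k ⊆ Set.Ioi (Real.sqrt 5 / (2 * (k : ℝ) - 1)) ∧
    IsLeast {y : ℝ | AccPt y (Filter.principal (KLagrange.lagrangeSpectrum k))}
      (Real.sqrt 5 / (2 * (k : ℝ) - 1)) ∧
    ¬ IsClosed (KLagrange.lagrangeSpectrum k) := by
  have hsub := KLagrange.lagrangeSpectrum_subset hk
  have hacc := KLagrange.accPt_lagrangeSpectrum hk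
  refine ⟨hsub, ⟨hacc, fun y hy => ?_⟩, fun hcl => ?_⟩
  · have h1 := closure_mono hsub (mem_closure_iff_clusterPt.mpr (AccPt.clusterPt hy))
    rwa [closure_Ioi] at h1
  · have h1 := mem_closure_iff_clusterPt.mpr hacc.clusterPt
    rw [hcl.closure_eq] at h1
    exact lt_irrefl _ (Set.mem_Ioi.mp (hsub h1))
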